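/- **Setting.** Let $p\ge 1$ and let $H_0=N(0,I_{p+1})$ be the law of $(y,x)\in\mathbb R\times\mathbb R^p$ (the Gaussian model). A *loss function* is a function $\rho:\mathbb R\to\mathbb R$ that is symmetric, nondecreasing on $[0,\infty)$, with $\rho(0)=0$, $\lim_{u\to\infty}\rho(u)=1$, and only finitely many discontinuities. Let $\rho_1\ge\rho_2$ be loss functions, let $b\in(0,1)$ and $0<\varepsilon<\min\{b,1-b\}$, and let $V_\varepsilon=\{(1-\varepsilon)H_0+\varepsilon H^* : H^* \text{ a probability distribution on } \mathbb R^{p+1}\}$. For a functional $T$ with values in $\mathbb R^p$ put $B_T(\varepsilon)=\sup_{H\in V_\varepsilon}\|T(H)\|\in[0,\infty]$. Let $(t_S,T_S,s)$ be an S-functional: for every $H\in V_\varepsilon$, $(t_S(H),T_S(H),s(H))$ minimizes $\sigma>0$ over all $(\alpha,\theta,\sigma)\in\mathbb R\times\mathbb R^p\times(0,\infty)$ subject to $E_H\,\rho_1\big((y-\alpha-x'\theta)/\sigma\big)\le b$. Let $(t_{MM},T_{MM})$ be an MM-functional: for every $H\in V_\varepsilon$, $(t_{MM}(H),T_{MM}(H))$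 minimizes $E_H\,\rho_2\big((y-\alpha-x'\theta)/s(H)\big)$ over $(\alpha,\theta)\in\mathbb R\times\mathbb R^p$. Write $B_S=B_{T_S}$ and $B_{MM}=B_{T_{MM}}$. With $\bar s=\sup_{H\in V_\varepsilon}s(H)$ let $$h_1(t)=\inf_{\|\theta\|=t}\ \inf_{\alpha\in\mathbb R}E_{H_0}\rho_2\Big(\frac{y-\alpha-x'\theta}{\bar s}\Big)-E_{H_0}\rho_2\Big(\frac{y}{\bar s}\Big),\qquad h_1^{-1}(v)=\inf\{t\ge0: h_1(t)\ge v\}\quad(\inf\emptyset=\infty).$$ For $i=1,2$ let $g_i(s)=E\,\rho_i(Z/s)$, $s>0$, with $Z$ standard normal, and let $g_i^{-1}(v)=\inf\{s>0: g_i(s)\le v\}$, which is the usual inverse at values $v$ of $g_i$. Put $\sigma_{b,\varepsilon}=g_1^{-1}\big[\tfrac{b-\varepsilon}{1-\varepsilon}\big]$, $\gamma_{b,\varepsilon}=g_1^{-1}\big[\tfrac{b}{1-\varepsilon}\big]$ and $$\ell(\varepsilon)=\left[\left(\frac{\sigma_{b,\varepsilon}}{g_2^{-1}\big[g_2(\sigma_{b,\varepsilon})+\frac{\varepsilon}{1-\varepsilon}\big]}\right)^2-1\right]^{1/2},\qquad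 u(\varepsilon)=\left[\left(\frac{\gamma_{b,\varepsilon}}{g_2^{-1}\big[g_2(\gamma_{b,\varepsilon})+\frac{\varepsilon}{1-\varepsilon}\big]}\right)^2-1\right]^{1/2},$$ where a quotient is $\infty$ when the argument of $g_2^{-1}$ in it is at least $1$ (so that $g_2^{-1}$ takes the value $0$). **Theorem.** Suppose that $B_S(\varepsilon)<h_1^{-1}\big(\tfrac{\varepsilon}{1-\varepsilon}\big)$, that $g_2$ is continuously differentiable on $(0,\infty)$, and that $\phi_2(s)=-s\,g_2'(s)$ is unimodal: for some $\sigma_M>0$ it is nondecreasing on $(0,\sigma_M]$ and nonincreasing on $[\sigma_M,\infty)$. Then $$\ell(\varepsilon)\le B_{MM}(\varepsilon)\le\max\{\ell(\varepsilon),u(\varepsilon)\}.$$ In particular, $B_{MM}(\varepsilon)=\ell(\varepsilon)$ whenever $u(\varepsilon)\le\ell(\varepsilon)$. -/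

import Mathlib

open MeasureTheory ProbabilityTheory Set
open scoped ENNReal RealInnerProductSpace

noncomputable section

namespace MMRegression

/-- Loss functions: symmetric, nondecreasing on `[0, ∞)`, vanishing at `0`, tending to `1` at
infinity (hence bounded), with finitely many discontinuities. -/
structure IsLoss (ρ : ℝ → ℝ) : Prop where
  symm : ∀ u, ρ (-u) = ρ u
  mono : MonotoneOn ρ (Ici 0)
  zero : ρ 0 = 0
  tendsto_one : Filter.Tendsto ρ Filter.atTop (nhds 1)
  finite_disc : {u | ¬ ContinuousAt ρ u}.Finite

/-- The space of observations `(y, x)`, with `y ∈ ℝ` and `x ∈ ℝᵖ`. -/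
abbrev Obs (p : ℕ) : Type := ℝ × EuclideanSpace ℝ (Fin p)

/-- The Gaussian model: `(y, x)` has the standard normal law `N(0, I_{p+1})`. -/
def gaussianModel (p : ℕ) : Measure (Obs p) :=
  (gaussianReal 0 1).prod (stdGaussian (EuclideanSpace ℝ (Fin p)))

/-- The contamination neighbourhood `V_ε = {(1 - ε) H₀ + ε H*}` of the Gaussian model, with `H*`
ranging over all probability distributions. -/
def contamination (p : ℕ) (ε : ℝ) : Set (Measure (Obs p)) :=
  {H | ∃ K : Measure (Obs p), IsProbabilityMeasure K ∧
    H = ENNReal.ofReal (1 - ε) • gaussianModel p + ENNReal.ofReal ε • K}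

/-- The expected loss `E_H ρ((y - α - x'θ) / s)`. -/
def risk {p : ℕ} (ρ : ℝ → ℝ) (H : Measure (Obs p)) (α : ℝ) (θ : EuclideanSpace ℝ (Fin p))
    (s : ℝ) : ℝ :=
  ∫ z, ρ ((z.1 - α - ⟪z.2, θ⟫) / s) ∂H

/-- `(α, θ, σ)` is an S-solution at `H`: it minimizes `σ > 0` subject to
`E_H ρ((y - α - x'θ) / σ) ≤ b`. -/
structure IsSSolution {p : ℕ} (ρ : ℝ → ℝ) (b : ℝ) (H : Measure (Obs p)) (α : ℝ)
    (θ : EuclideanSpace ℝ (Fin p)) (σ : ℝ) : Prop where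
  pos : 0 < σ
  feasible : risk ρ H α θ σ ≤ b
  minimal : ∀ (α' : ℝ) (θ' : EuclideanSpace ℝ (Fin p)) (σ' : ℝ),
    0 < σ' → risk ρ H α' θ' σ' ≤ b → σ ≤ σ'

/-- `(α, θ)` is an MM-solution at `H` with preliminary scale `s`: it minimizes
`E_H ρ((y - α - x'θ) / s)`. -/
def IsMMSolution {p : ℕ} (ρ : ℝ → ℝ) (s : ℝ) (H : Measure (Obs p)) (α : ℝ)
    (θ : EuclideanSpace ℝ (Fin p)) : Prop :=
  ∀ (α' : ℝ) (θ' : EuclideanSpace ℝ (Fin p)), risk ρ H α θ s ≤ risk ρ H α' θ' s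

/-- The maximum bias `sup {‖T(H)‖ | H ∈ V_ε}` of a slope functional `T`, in `[0, ∞]`. -/
def maxBias {p : ℕ} (T : Measure (Obs p) → EuclideanSpace ℝ (Fin p)) (ε : ℝ) : ℝ≥0∞ :=
  ⨆ H ∈ contamination p ε, ENNReal.ofReal ‖T H‖

/-- `m(t, s) = inf_{‖θ‖ = t} inf_α E_{H₀} ρ((y - α - x'θ) / s) - E_{H₀} ρ(y / s)`. -/
def mFun (p : ℕ) (ρ : ℝ → ℝ) (t s : ℝ) : ℝ :=
  (⨅ θ : Metric.sphere (0 : EuclideanSpace ℝ (Fin p)) t, ⨅ α : ℝ,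
    risk ρ (gaussianModel p) α θ s) - ∫ z, ρ (z.1 / s) ∂(gaussianModel p)

/-- `s̄ = sup_{H ∈ V_ε} s(H)` for a scale functional `s`. -/
def supScale {p : ℕ} (s : Measure (Obs p) → ℝ) (ε : ℝ) : ℝ :=
  sSup (s '' contamination p ε)

/-- The inverse at `v` of a nondecreasing function `h` on `[0, ∞)`, equal to `∞` if `h` stays
below `v`. -/
def incInv (h : ℝ → ℝ) (v : ℝ) : ℝ≥0∞ :=
  ⨅ t ∈ {t : ℝ | 0 ≤ t ∧ v ≤ h t}, ENNReal.ofReal t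

/-- `g(s) = E ρ(Z / s)` for a standard normal variable `Z`. -/
def g (ρ : ℝ → ℝ) (s : ℝ) : ℝ := ∫ z, ρ (z / s) ∂(gaussianReal 0 1)

/-- The inverse of the decreasing function `g` on `(0, ∞)`, equal to `0` at values `v ≥ 1`, where
`1 = lim_{s → 0} g(s)`. -/
def gInv (ρ : ℝ → ℝ) (v : ℝ) : ℝ := sInf {s : ℝ | 0 < s ∧ g ρ s ≤ v}

/-- The smoothness and unimodality condition on a function `G` on `(0, ∞)`: `G` is continuously
differentiable and `φ(s) = -s G'(s)` is unimodal, with its maximum attained at some `σ_M > 0`. -/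
structure IsUnimodalScore (G : ℝ → ℝ) : Prop where
  contDiff : ContDiffOn ℝ 1 G (Ioi 0)
  unimodal : ∃ σM : ℝ, 0 < σM ∧ MonotoneOn (fun s => -s * deriv G s) (Ioc 0 σM) ∧
    AntitoneOn (fun s => -s * deriv G s) (Ici σM)

/-- `σ_{b,ε} = g⁻¹[(b - ε) / (1 - ε)]`. -/
def sigmaScale (ρ : ℝ → ℝ) (b ε : ℝ) : ℝ := gInv ρ ((b - ε) / (1 - ε))

/-- `γ_{b,ε} = g⁻¹[b / (1 - ε)]`. -/
def gammaScale (ρ : ℝ → ℝ) (b ε : ℝ) : ℝ := gInv ρ (b / (1 - ε))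

/-- `[(s / g⁻¹[g(s) + ε / (1 - ε)])² - 1]^{1/2}` in `[0, ∞]`; it is `∞` when
`g(s) + ε / (1 - ε) ≥ 1`. -/
def biasAt (ρ : ℝ → ℝ) (ε s : ℝ) : ℝ≥0∞ :=
  ((ENNReal.ofReal s / ENNReal.ofReal (gInv ρ (g ρ s + ε / (1 - ε)))) ^ 2 - 1) ^ (1 / 2 : ℝ)

/-- The lower bound `ℓ(ε)`. -/
def lowerBound (ρ₁ ρ₂ : ℝ → ℝ) (b ε : ℝ) : ℝ≥0∞ := biasAt ρ₂ ε (sigmaScale ρ₁ b ε)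

/-- The quantity `u(ε)`. -/
def upperTerm (ρ₁ ρ₂ : ℝ → ℝ) (b ε : ℝ) : ℝ≥0∞ := biasAt ρ₂ ε (gammaScale ρ₁ b ε)

end MMRegression

end

open MMRegression

/-! Under the Gaussian model a residual is centred normal with variance `1 + ‖θ‖²`, and Anderson's
inequality makes the zero intercept optimal. Every Gaussian risk is thus at least `g ρ (s / √(1 +
‖θ‖²))`, and the contamination adds between `0` and `ε`.

Upper bound. Comparing an MM-fit of slope norm `t` and scale `s` with the zero fit forces
`g₂(s/√(1+t²)) - g₂(s) ≤ ε/(1-ε)`, which fails once `t` exceeds `biasAt ρ₂ ε s`. The S-scale lies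
between `gammaScale` and `sigmaScale`. Unimodality makes that difference quasi-concave in `s`
(`IsUnimodalScore.lt_sub`), so only the two end scales matter.

Lower bound. Put the mass `ε` at a remote point lying exactly on a plane of slope norm `t`, with
`B_S < t < ℓ(ε)`. The S-fit cannot follow it, so its scale is driven up to `sigmaScale`
(`eventually_lt_scale`). At that scale, following the outlier costs the MM-fit less than ignoring
it, so its slope norm gets arbitrarily close to `ℓ(ε)` (`biasAt_le_maxBias`). The hypothesis on
`h₁⁻¹` supplies the room: it yields `B_S < ℓ(ε)`. -/

namespace MMRegression

open Filter Topology

/-! ### Loss functions, the function `g`, and Anderson's inequality -/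

namespace IsLoss

variable {ρ : ℝ → ℝ}

lemma apply_abs (h : IsLoss ρ) (u : ℝ) : ρ |u| = ρ u := by
  rcases abs_choice u with hu | hu <;> rw [hu]
  exact h.symm u

lemma le_of_abs_le (h : IsLoss ρ) {u v : ℝ} (huv : |u| ≤ |v|) : ρ u ≤ ρ v := by
  rw [← h.apply_abs u, ← h.apply_abs v]
  exact h.mono (abs_nonneg u) (abs_nonneg v) huv

lemma nonneg (h : IsLoss ρ) (u : ℝ) : 0 ≤ ρ u := by
  rw [← h.zero]
  exact h.le_of_abs_le (by simp)

lemma le_one (h : IsLoss ρ) (u : ℝ) : ρ u ≤ 1 := by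
  refine ge_of_tendsto h.tendsto_one ?_
  filter_upwards [eventually_ge_atTop |u|] with v hv
  exact h.le_of_abs_le (hv.trans (le_abs_self v))

lemma norm_le_one (h : IsLoss ρ) (u : ℝ) : ‖ρ u‖ ≤ 1 := by
  rw [Real.norm_eq_abs, abs_of_nonneg (h.nonneg u)]
  exact h.le_one u

lemma measurable (h : IsLoss ρ) : Measurable ρ := by
  have hm : Monotone fun u => ρ (max u 0) := fun u v huv =>
    h.mono (mem_Ici.2 (le_max_right _ _)) (mem_Ici.2 (le_max_right _ _)) (max_le_max_right 0 huv)
  have : ρ = fun u => (fun u => ρ (max u 0)) |u| := by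
    funext u
    simp [h.apply_abs]
  rw [this]
  exact hm.measurable.comp measurable_abs

lemma integrable {Ω : Type*} [MeasurableSpace Ω] {μ : Measure Ω} [IsFiniteMeasure μ]
    (h : IsLoss ρ) {f : Ω → ℝ} (hf : Measurable f) : Integrable (fun z => ρ (f z)) μ :=
  Integrable.of_bound (h.measurable.comp hf).aestronglyMeasurable 1
    (Eventually.of_forall fun _ => h.norm_le_one _)

lemma integral_le_one {Ω : Type*} [MeasurableSpace Ω] {μ : Measure Ω} [IsProbabilityMeasure μ]
    (h : IsLoss ρ) {f : Ω → ℝ} (hf : Measurable f) : ∫ z, ρ (f z) ∂μ ≤ 1 := by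
  refine (integral_mono (h.integrable hf) (integrable_const 1) fun z => h.le_one _).trans ?_
  simp

lemma integral_nonneg {Ω : Type*} [MeasurableSpace Ω] {μ : Measure Ω}
    (h : IsLoss ρ) (f : Ω → ℝ) : 0 ≤ ∫ z, ρ (f z) ∂μ :=
  MeasureTheory.integral_nonneg fun _ => h.nonneg _

/-- If the argument of a loss function escapes to infinity almost everywhere, then the expected
loss tends to one. -/
lemma tendsto_integral_one {Ω : Type*} [MeasurableSpace Ω] {μ : Measure Ω}
    [IsProbabilityMeasure μ] (h : IsLoss ρ) {l : Filter ℝ} [l.IsCountablyGenerated]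
    {F : ℝ → Ω → ℝ} (hF : ∀ a, Measurable (F a))
    (hlim : ∀ᵐ z ∂μ, Tendsto (fun a => F a z) l atTop) :
    Tendsto (fun a => ∫ z, ρ (F a z) ∂μ) l (𝓝 1) := by
  have := tendsto_integral_filter_of_dominated_convergence (μ := μ) (l := l)
    (F := fun a z => ρ (F a z)) (f := fun _ => (1 : ℝ)) (fun _ => 1)
    (Eventually.of_forall fun a => (h.measurable.comp (hF a)).aestronglyMeasurable)
    (Eventually.of_forall fun a => Eventually.of_forall fun z => h.norm_le_one _)
    (integrable_const _)
    (hlim.mono fun z hz => h.tendsto_one.comp hz)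
  simpa using this

lemma g_le_one (h : IsLoss ρ) (s : ℝ) : g ρ s ≤ 1 := h.integral_le_one (by fun_prop)

lemma antitoneOn_g (h : IsLoss ρ) : AntitoneOn (g ρ) (Ioi 0) := by
  intro s hs s' hs' hss
  rw [mem_Ioi] at hs hs'
  refine integral_mono (h.integrable (by fun_prop)) (h.integrable (by fun_prop)) fun z =>
    h.le_of_abs_le ?_
  rw [abs_div, abs_div, abs_of_pos hs, abs_of_pos hs']
  gcongr

lemma tendsto_g_zero (h : IsLoss ρ) : Tendsto (g ρ) (𝓝[>] 0) (𝓝 1) := by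
  have key : Tendsto (fun s : ℝ => ∫ z, ρ (|z| * s⁻¹) ∂(gaussianReal 0 1)) (𝓝[>] 0) (𝓝 1) := by
    refine h.tendsto_integral_one (fun a => by fun_prop) ?_
    have h0 : ∀ᵐ z ∂(gaussianReal 0 1), z ≠ 0 :=
      (gaussianReal_absolutelyContinuous 0 one_ne_zero).ae_le (Measure.ae_ne volume 0)
    filter_upwards [h0] with z hz
    exact tendsto_inv_nhdsGT_zero.const_mul_atTop (abs_pos.2 hz)
  refine key.congr' ?_
  filter_upwards [self_mem_nhdsWithin] with s hs
  refine integral_congr_ae (Eventually.of_forall fun z => ?_)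
  rw [mem_Ioi] at hs
  change ρ (|z| * s⁻¹) = ρ (z / s)
  rw [← h.apply_abs (z / s), abs_div, abs_of_pos hs, div_eq_mul_inv]

/-- A loss function invariant, almost everywhere, under a dilation is identically one off the
origin. -/
lemma eq_one_of_ae_dilation (h : IsLoss ρ) {k : ℝ} (hk : 1 < k)
    (hae : ∀ᵐ z : ℝ, ρ (k * z) = ρ z) {x : ℝ} (hx : 0 < x) : ρ x = 1 := by
  -- The square root leaves an interval of positive measure for a good `z`: if `x/q < z < x`, then
  -- `ρ z ≤ ρ x ≤ ρ (q x) ≤ ρ (k z) = ρ z`.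
  set q := √k with hq
  have hq1 : 1 < q := Real.lt_sqrt_of_sq_lt (by simpa using hk)
  have hq0 : 0 < q := by linarith
  have hqk : q * q = k := Real.mul_self_sqrt (by linarith)
  have step : ∀ x : ℝ, 0 < x → ρ (q * x) = ρ x := by
    intro x hx
    have hpos : 0 < volume (Ioo (x / q) x) := by
      rw [Real.volume_Ioo, ENNReal.ofReal_pos, sub_pos]
      exact div_lt_self hx hq1
    obtain ⟨z, ⟨hz1, hz2⟩, hz⟩ :=
      ((frequently_ae_mem_iff.2 hpos.ne').and_eventually hae).exists
    have hz0 : 0 < z := (div_pos hx hq0).trans hz1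
    have h1 : ρ z ≤ ρ x := h.mono hz0.le hx.le hz2.le
    have h2 : ρ x ≤ ρ (q * x) := h.mono hx.le (by positivity : 0 ≤ q * x) (by nlinarith)
    have hle : q * x ≤ k * z := by
      rw [div_lt_iff₀ hq0] at hz1
      nlinarith
    have h3 : ρ (q * x) ≤ ρ (k * z) :=
      h.mono (by positivity : 0 ≤ q * x) (by positivity : 0 ≤ k * z) hle
    linarith
  have hpow : ∀ n : ℕ, ρ (q ^ n * x) = ρ x := by
    intro n
    induction n with
    | zero => simp
    | succ n ih => rw [pow_succ', mul_assoc, step _ (by positivity), ih]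
  have hlim : Tendsto (fun n : ℕ => ρ (q ^ n * x)) atTop (𝓝 1) :=
    h.tendsto_one.comp ((tendsto_pow_atTop_atTop_of_one_lt hq1).atTop_mul_const hx)
  simp only [hpow] at hlim
  exact tendsto_nhds_unique tendsto_const_nhds hlim

/-- Unless the loss function is identically one off the origin, `g` is strictly decreasing. -/
lemma strictAntiOn_g (h : IsLoss ρ) {s₀ : ℝ} (hs₀ : 0 < s₀) (hlt : g ρ s₀ < 1) :
    StrictAntiOn (g ρ) (Ioi 0) := by
  intro s hs s' hs' hss
  refine lt_of_le_of_ne (h.antitoneOn_g hs hs' hss.le) fun heq => hlt.ne ?_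
  rw [mem_Ioi] at hs hs'
  have hle : ∀ z, ρ (z / s') ≤ ρ (z / s) := fun z => h.le_of_abs_le (by
    rw [abs_div, abs_div, abs_of_pos hs, abs_of_pos hs']
    gcongr)
  -- Equality of the two integrals makes `ρ` invariant a.e. under dilation by `s'/s > 1`, hence
  -- equal to one off the origin, which contradicts `g ρ s₀ < 1`.
  have hzero : ∫ z, (ρ (z / s) - ρ (z / s')) ∂(gaussianReal 0 1) = 0 := by
    rw [integral_sub (h.integrable (by fun_prop)) (h.integrable (by fun_prop))]
    exact sub_eq_zero.2 heq.symm
  rw [integral_eq_zero_iff_of_nonneg (fun z => sub_nonneg.2 (hle z))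
    ((h.integrable (by fun_prop)).sub (h.integrable (by fun_prop)))] at hzero
  have hvol : ∀ᵐ z : ℝ, ρ (z / s) = ρ (z / s') :=
    (gaussianReal_absolutelyContinuous' 0 one_ne_zero).ae_le
      (hzero.mono fun z hz => sub_eq_zero.1 hz)
  have hscale : ∀ᵐ z : ℝ, ρ (s' / s * z) = ρ z := by
    have hq : Measure.QuasiMeasurePreserving (fun z : ℝ => s' * z) volume volume := by
      refine ⟨by fun_prop, ?_⟩
      rw [Real.map_volume_mul_left hs'.ne']
      exact Measure.smul_absolutelyContinuous
    filter_upwards [hq.ae hvol] with z hz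
    rw [mul_div_right_comm, mul_div_cancel_left₀ _ hs'.ne'] at hz
    exact hz
  have hone : ∀ᵐ z ∂(gaussianReal 0 1), ρ (z / s₀) = 1 := by
    have h0 : ∀ᵐ z ∂(gaussianReal 0 1), z ≠ 0 :=
      (gaussianReal_absolutelyContinuous 0 one_ne_zero).ae_le (Measure.ae_ne volume 0)
    filter_upwards [h0] with z hz
    rw [← h.apply_abs]
    exact h.eq_one_of_ae_dilation ((one_lt_div hs).2 hss) hscale
      (abs_pos.2 (div_ne_zero hz hs₀.ne'))
  unfold g
  rw [integral_congr_ae hone]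
  simp

/-- The one-dimensional Anderson inequality for a loss function. -/
lemma g_le_integral_shift (h : IsLoss ρ) {τ s : ℝ} (hτ : 0 < τ) (hs : 0 < s) (α : ℝ) :
    g ρ (s / τ) ≤ ∫ z, ρ ((τ * z - α) / s) ∂(gaussianReal 0 1) := by
  set a := α / τ with ha
  set ψ : ℝ → ℝ := fun z => ρ (z / (s / τ)) with hψ
  have hψm : Measurable ψ := h.measurable.comp (by fun_prop)
  have hshift : ∀ z, ρ ((τ * z - α) / s) = ψ (z - a) := fun z => by
    simp only [hψ, ha]
    congr 1
    field_simp
  have hψmono : ∀ u v, |u| ≤ |v| → ψ u ≤ ψ v := fun u v huv => h.le_of_abs_le (by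
    rw [abs_div u, abs_div v]
    gcongr)
  have hψsymm : ∀ u v, |u| = |v| → ψ u = ψ v := fun u v huv =>
    le_antisymm (hψmono u v huv.le) (hψmono v u huv.ge)
  set φ : ℝ → ℝ := gaussianPDFReal 0 1 with hφ
  have hφanti : ∀ u v, |u| ≤ |v| → φ v ≤ φ u := fun u v huv => by
    simp only [hφ, gaussianPDFReal, sub_zero]
    refine mul_le_mul_of_nonneg_left (Real.exp_le_exp.2 ?_) (by positivity)
    exact div_le_div_of_nonneg_right (neg_le_neg (sq_le_sq.2 huv)) (by positivity)
  have hφsymm : ∀ u v, |u| = |v| → φ u = φ v := fun u v huv =>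
    le_antisymm (hφanti v u huv.ge) (hφanti u v huv.le)
  simp only [hshift, g]
  rw [integral_gaussianReal_eq_integral_smul one_ne_zero,
    integral_gaussianReal_eq_integral_smul one_ne_zero]
  have hint : ∀ c d, Integrable (fun z => φ (z - c) * ψ (z - d)) := fun c d =>
    ((integrable_gaussianPDFReal 0 1).comp_sub_right c).mul_bdd (c := 1)
      (hψm.comp (by fun_prop)).aestronglyMeasurable
      (Eventually.of_forall fun z => h.norm_le_one _)
  have i00 : Integrable (fun z => φ z * ψ z) := by simpa using hint 0 0
  have i0a : Integrable (fun z => φ z * ψ (z - a)) := by simpa using hint 0 a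
  have ia0 : Integrable (fun z => φ (z - a) * ψ z) := by simpa using hint a 0
  have haa := hint a a
  have e1 : ∫ z, φ (z - a) * ψ (z - a) = ∫ z, φ z * ψ z :=
    integral_sub_right_eq_self (fun z => φ z * ψ z) a
  have e2 : ∫ z, φ (z - a) * ψ z = ∫ z, φ z * ψ (z - a) := by
    rw [← integral_sub_left_eq_self _ volume a]
    refine integral_congr_ae (Eventually.of_forall fun z => ?_)
    simp only
    rw [hφsymm (a - z - a) z (by rw [sub_sub_cancel_left, abs_neg]),
      hψsymm (a - z) (z - a) (abs_sub_comm _ _)]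
  -- The integrand is `(φ z - φ (z - a)) (ψ (z - a) - ψ z)`, whose factors have the same sign
  -- because both are ruled by comparing `|z|` with `|z - a|`. By `e1` and `e2` its integral is
  -- twice the desired difference.
  have hnn : 0 ≤ ∫ z, ((φ z * ψ (z - a) - φ z * ψ z) - (φ (z - a) * ψ (z - a) - φ (z - a) * ψ z)) :=
    MeasureTheory.integral_nonneg fun z => by
      have : (φ z * ψ (z - a) - φ z * ψ z) - (φ (z - a) * ψ (z - a) - φ (z - a) * ψ z)
          = (φ z - φ (z - a)) * (ψ (z - a) - ψ z) := by ring
      simp only [this, Pi.zero_apply]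
      rcases le_total |z| |z - a| with hz | hz
      · exact mul_nonneg (sub_nonneg.2 (hφanti _ _ hz)) (sub_nonneg.2 (hψmono _ _ hz))
      · exact mul_nonneg_of_nonpos_of_nonpos (sub_nonpos.2 (hφanti _ _ hz))
          (sub_nonpos.2 (hψmono _ _ hz))
  rw [integral_sub (f := fun z => φ z * ψ (z - a) - φ z * ψ z)
    (g := fun z => φ (z - a) * ψ (z - a) - φ (z - a) * ψ z) (i0a.sub i00) (haa.sub ia0),
    integral_sub i0a i00, integral_sub haa ia0, e1, e2] at hnn
  simp only [smul_eq_mul]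
  change ∫ z, φ z * ψ z ≤ _
  linarith

end IsLoss

/-! ### Residuals under the Gaussian model -/

section Gaussian

variable {p : ℕ}

instance : IsProbabilityMeasure (gaussianModel p) := by
  unfold gaussianModel
  infer_instance

/-- Under the Gaussian model the residual `y - x'θ` is centred normal with variance
`1 + ‖θ‖²`. -/
lemma map_residual_gaussianModel (θ : EuclideanSpace ℝ (Fin p)) :
    (gaussianModel p).map (fun z => z.1 - ⟪z.2, θ⟫) =
      (gaussianReal 0 1).map (fun z => √(1 + ‖θ‖ ^ 2) * z) := by
  have hm : Measurable fun z : Obs p => z.1 - ⟪z.2, θ⟫ := by fun_prop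
  have := Measure.isProbabilityMeasure_map (μ := gaussianModel p) hm.aemeasurable
  rw [gaussianReal_map_const_mul]
  refine Measure.ext_of_charFun (funext fun u => ?_)
  rw [charFun_gaussianReal, charFun_apply_real, integral_map hm.aemeasurable (by fun_prop),
    gaussianModel]
  have hsplit : ∀ z : Obs p, Complex.exp (u * ((z.1 - ⟪z.2, θ⟫ : ℝ) : ℂ) * Complex.I) =
      Complex.exp (u * (z.1 : ℂ) * Complex.I) *
        Complex.exp ((⟪z.2, (-u) • θ⟫ : ℝ) * Complex.I) := fun z => by
    rw [← Complex.exp_add, inner_smul_right]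
    push_cast
    ring_nf
  simp only [hsplit]
  rw [integral_prod_mul (fun y : ℝ => Complex.exp (u * (y : ℂ) * Complex.I))
    (fun x : EuclideanSpace ℝ (Fin p) => Complex.exp ((⟪x, (-u) • θ⟫ : ℝ) * Complex.I)),
    ← charFun_apply_real, ← charFun_apply, charFun_gaussianReal, charFun_stdGaussian,
    ← Complex.exp_add, norm_smul]
  congr 1
  have hsq : (√(1 + ‖θ‖ ^ 2)) ^ 2 = 1 + ‖θ‖ ^ 2 := Real.sq_sqrt (by positivity)
  simp only [NNReal.coe_mul, NNReal.coe_one, NNReal.coe_mk, hsq, Real.norm_eq_abs, abs_neg]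
  push_cast
  ring_nf
  simp [← Complex.ofReal_pow]

lemma risk_gaussianModel {ρ : ℝ → ℝ} (h : IsLoss ρ) (α : ℝ) (θ : EuclideanSpace ℝ (Fin p))
    (s : ℝ) : risk ρ (gaussianModel p) α θ s =
      ∫ z, ρ ((√(1 + ‖θ‖ ^ 2) * z - α) / s) ∂(gaussianReal 0 1) := by
  have hρ := h.measurable
  have hψ : Measurable fun r => ρ ((r - α) / s) := hρ.comp (by fun_prop)
  have h1 := integral_map (μ := gaussianModel p) (φ := fun z => z.1 - ⟪z.2, θ⟫)
    (by fun_prop : Measurable _).aemeasurable (f := fun r => ρ ((r - α) / s))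
    hψ.aestronglyMeasurable
  rw [map_residual_gaussianModel, integral_map (by fun_prop) hψ.aestronglyMeasurable] at h1
  rw [h1, risk]
  refine integral_congr_ae (Eventually.of_forall fun z => ?_)
  simp only
  rw [sub_right_comm]

end Gaussian

/-! ### Risks under contamination and remote point masses -/

section Risk

variable {p : ℕ} {ρ : ℝ → ℝ}

lemma one_le_sqrt_one_add_sq (t : ℝ) : 1 ≤ √(1 + t ^ 2) :=
  Real.one_le_sqrt.2 (by linarith [sq_nonneg t])

lemma risk_gaussianModel_zero (h : IsLoss ρ) (θ : EuclideanSpace ℝ (Fin p)) (s : ℝ) :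
    risk ρ (gaussianModel p) 0 θ s = g ρ (s / √(1 + ‖θ‖ ^ 2)) := by
  rw [risk_gaussianModel h, g]
  refine integral_congr_ae (Eventually.of_forall fun z => ?_)
  simp only [sub_zero]
  rw [div_div_eq_mul_div, mul_comm]

lemma g_le_risk_gaussianModel (h : IsLoss ρ) (α : ℝ) (θ : EuclideanSpace ℝ (Fin p)) {s : ℝ}
    (hs : 0 < s) : g ρ (s / √(1 + ‖θ‖ ^ 2)) ≤ risk ρ (gaussianModel p) α θ s := by
  rw [risk_gaussianModel h]
  exact h.g_le_integral_shift (by positivity) hs α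

lemma g_le_g_div (h : IsLoss ρ) {s k : ℝ} (hs : 0 < s) (hk : 1 ≤ k) : g ρ s ≤ g ρ (s / k) :=
  h.antitoneOn_g (div_pos hs (by linarith) : 0 < s / k) hs (div_le_self hs.le hk)

lemma integral_fst_gaussianModel (h : IsLoss ρ) (s : ℝ) :
    ∫ z, ρ (z.1 / s) ∂(gaussianModel p) = g ρ s := by
  have := risk_gaussianModel_zero (p := p) h 0 s
  simpa [risk] using this

/-- Both infima disappear: Anderson's inequality puts the best intercept at `0`, and the risk then
depends on the slope only through its norm. -/
lemma mFun_eq (hp : 1 ≤ p) (h : IsLoss ρ) {t s : ℝ} (ht : 0 ≤ t) (hs : 0 < s) :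
    mFun p ρ t s = g ρ (s / √(1 + t ^ 2)) - g ρ s := by
  have : NeZero p := ⟨by lia⟩
  have : Nonempty (Metric.sphere (0 : EuclideanSpace ℝ (Fin p)) t) :=
    (NormedSpace.sphere_nonempty.2 ht).to_subtype
  have hα : ∀ θ : Metric.sphere (0 : EuclideanSpace ℝ (Fin p)) t,
      ⨅ α : ℝ, risk ρ (gaussianModel p) α θ s = g ρ (s / √(1 + t ^ 2)) := fun θ => by
    have hθ : ‖(θ : EuclideanSpace ℝ (Fin p))‖ = t := by simp
    refine le_antisymm ?_ (le_ciInf fun α => ?_)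
    · refine (ciInf_le ⟨0, ?_⟩ 0).trans_eq ?_
      · rintro _ ⟨α, rfl⟩
        exact h.integral_nonneg _
      · rw [risk_gaussianModel_zero h, hθ]
    · simpa [hθ] using g_le_risk_gaussianModel h α θ.1 hs
  rw [mFun, integral_fst_gaussianModel h]
  simp only [hα, ciInf_const]

lemma risk_contamination (h : IsLoss ρ) {ε : ℝ} (hε : 0 ≤ ε) (hε1 : ε ≤ 1) (K : Measure (Obs p))
    [IsProbabilityMeasure K] (α : ℝ) (θ : EuclideanSpace ℝ (Fin p)) (s : ℝ) :
    risk ρ (ENNReal.ofReal (1 - ε) • gaussianModel p + ENNReal.ofReal ε • K) α θ s =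
      (1 - ε) * risk ρ (gaussianModel p) α θ s + ε * risk ρ K α θ s := by
  have hm : Measurable fun z : Obs p => (z.1 - α - ⟪z.2, θ⟫) / s := by fun_prop
  unfold risk
  rw [integral_add_measure ((h.integrable hm).smul_measure ENNReal.ofReal_ne_top)
    ((h.integrable hm).smul_measure ENNReal.ofReal_ne_top), integral_smul_measure,
    integral_smul_measure, ENNReal.toReal_ofReal hε, ENNReal.toReal_ofReal (by linarith)]
  rfl

lemma mul_g_le_risk (h : IsLoss ρ) {ε : ℝ} (hε : 0 ≤ ε) (hε1 : ε ≤ 1) {H : Measure (Obs p)}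
    (hH : H ∈ contamination p ε) (α : ℝ) (θ : EuclideanSpace ℝ (Fin p)) {s : ℝ} (hs : 0 < s) :
    (1 - ε) * g ρ (s / √(1 + ‖θ‖ ^ 2)) ≤ risk ρ H α θ s := by
  obtain ⟨K, hK, rfl⟩ := hH
  rw [risk_contamination h hε hε1]
  have h1 := mul_le_mul_of_nonneg_left (g_le_risk_gaussianModel h α θ hs) (sub_nonneg.2 hε1)
  have h2 : 0 ≤ ε * risk ρ K α θ s := mul_nonneg hε (h.integral_nonneg _)
  linarith

lemma risk_zero_le (h : IsLoss ρ) {ε : ℝ} (hε : 0 ≤ ε) (hε1 : ε ≤ 1) {H : Measure (Obs p)}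
    (hH : H ∈ contamination p ε) (s : ℝ) : risk ρ H 0 0 s ≤ (1 - ε) * g ρ s + ε := by
  obtain ⟨K, hK, rfl⟩ := hH
  rw [risk_contamination h hε hε1, risk_gaussianModel_zero h]
  have h2 : ε * risk ρ K 0 0 s ≤ ε * 1 :=
    mul_le_mul_of_nonneg_left (h.integral_le_one (by fun_prop)) hε
  simp only [norm_zero, ne_eq, OfNat.ofNat_ne_zero, not_false_eq_true, zero_pow, add_zero,
    Real.sqrt_one, div_one]
  linarith

/-- The contamination of the Gaussian model by a point mass at `(r t, r e)`, which the slope `t e`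
fits exactly. -/
noncomputable def pointContamination (ε t : ℝ) (e : EuclideanSpace ℝ (Fin p)) (r : ℝ) :
    Measure (Obs p) :=
  ENNReal.ofReal (1 - ε) • gaussianModel p + ENNReal.ofReal ε • Measure.dirac (r * t, r • e)

lemma pointContamination_mem (ε t : ℝ) (e : EuclideanSpace ℝ (Fin p)) (r : ℝ) :
    pointContamination ε t e r ∈ contamination p ε :=
  ⟨_, inferInstance, rfl⟩

lemma risk_pointContamination (h : IsLoss ρ) {ε : ℝ} (hε : 0 ≤ ε) (hε1 : ε ≤ 1) (t : ℝ)
    (e : EuclideanSpace ℝ (Fin p)) (r α : ℝ) (θ : EuclideanSpace ℝ (Fin p)) (s : ℝ) :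
    risk ρ (pointContamination ε t e r) α θ s =
      (1 - ε) * risk ρ (gaussianModel p) α θ s + ε * ρ ((r * t - α - r * ⟪e, θ⟫) / s) := by
  rw [pointContamination, risk_contamination h hε hε1]
  congr 2
  have hm : Measurable fun z : Obs p => (z.1 - α - ⟪z.2, θ⟫) / s := by fun_prop
  rw [risk, integral_dirac' (fun z : Obs p => ρ ((z.1 - α - ⟪z.2, θ⟫) / s)) _
    (h.measurable.comp hm).stronglyMeasurable]
  simp [inner_smul_left]

lemma risk_pointContamination_fit (h : IsLoss ρ) {ε : ℝ} (hε : 0 ≤ ε) (hε1 : ε ≤ 1) (t : ℝ)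
    {e : EuclideanSpace ℝ (Fin p)} (he : ‖e‖ = 1) (r s : ℝ) :
    risk ρ (pointContamination ε t e r) 0 (t • e) s = (1 - ε) * g ρ (s / √(1 + t ^ 2)) := by
  rw [risk_pointContamination h hε hε1, risk_gaussianModel_zero h, norm_smul, he, inner_smul_right,
    real_inner_self_eq_norm_sq, he]
  simp [h.zero]

/-- With slopes and scale bounded, the expected loss tends to one as the intercept grows. -/
lemma exists_lt_risk_gaussianModel (h : IsLoss ρ) {R S β : ℝ} (hS : 0 < S) (hβ : β < 1) :
    ∃ M, ∀ (α : ℝ) (θ : EuclideanSpace ℝ (Fin p)) (s : ℝ), M ≤ |α| → ‖θ‖ ≤ R → 0 < s → s ≤ S →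
      β < risk ρ (gaussianModel p) α θ s := by
  set T := √(1 + R ^ 2) with hT
  have hlim : Tendsto (fun a => ∫ z, ρ (max (a - T * |z|) 0 / S) ∂(gaussianReal 0 1)) atTop
      (𝓝 1) := by
    refine h.tendsto_integral_one (fun a => by fun_prop) (Eventually.of_forall fun z => ?_)
    refine Tendsto.atTop_div_const hS (tendsto_atTop_mono (fun a => le_max_left _ _) ?_)
    exact tendsto_atTop_add_const_right _ _ tendsto_id
  obtain ⟨M, hM⟩ := eventually_atTop.1 (hlim.eventually_const_lt hβ)
  refine ⟨M, fun α θ s hα hθ hs hsS => (hM |α| hα).trans_le ?_⟩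
  rw [risk_gaussianModel h]
  refine integral_mono (h.integrable (by fun_prop)) (h.integrable (by fun_prop)) fun z =>
    h.le_of_abs_le ?_
  have hτ : √(1 + ‖θ‖ ^ 2) ≤ T := by
    rw [hT]
    gcongr
  rw [abs_div, abs_div, abs_of_pos hS, abs_of_pos hs, abs_of_nonneg (le_max_right _ 0)]
  refine div_le_div₀ (abs_nonneg _) (max_le ?_ (abs_nonneg _)) hs hsS
  have h1 := abs_sub_abs_le_abs_sub α (√(1 + ‖θ‖ ^ 2) * z)
  rw [abs_mul, abs_of_nonneg (Real.sqrt_nonneg _), abs_sub_comm α] at h1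
  have h2 := mul_le_mul_of_nonneg_right hτ (abs_nonneg z)
  linarith

/-- If a fit does not follow the outlier of slope `t`, the outlier contributes a full unit of loss
in the limit. -/
lemma eventually_lt_risk_pointContamination (h : IsLoss ρ) {e : EuclideanSpace ℝ (Fin p)}
    (he : ‖e‖ = 1) {ε t R S v : ℝ} (hε : 0 < ε) (hε1 : ε < 1) (hRt : R < t) (hS : 0 < S)
    (hv : v < 1 - ε) (hv' : v < (1 - ε) * g ρ S + ε) :
    ∀ᶠ r in atTop, ∀ (α : ℝ) (θ : EuclideanSpace ℝ (Fin p)) (s : ℝ), ‖θ‖ ≤ R → 0 < s → s ≤ S →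
      v < risk ρ (pointContamination ε t e r) α θ s := by
  have h1ε : 0 < 1 - ε := by linarith
  obtain ⟨M, hM⟩ := exists_lt_risk_gaussianModel (p := p) h (R := R) hS ((div_lt_one h1ε).2 hv)
  have harg : Tendsto (fun r => (r * (t - R) - M) / S) atTop atTop :=
    Tendsto.atTop_div_const hS (tendsto_atTop_add_const_right _ _
      (tendsto_id.atTop_mul_const (sub_pos.2 hRt)))
  have hlim : Tendsto (fun r => (1 - ε) * g ρ S + ε * ρ ((r * (t - R) - M) / S)) atTop
      (𝓝 ((1 - ε) * g ρ S + ε * 1)) :=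
    ((h.tendsto_one.comp harg).const_mul ε).const_add _
  rw [mul_one] at hlim
  filter_upwards [hlim.eventually_const_lt hv', harg.eventually_ge_atTop 0, eventually_ge_atTop 0]
    with r hr hr0 hrpos α θ s hθ hs hsS
  rw [risk_pointContamination h hε.le hε1.le]
  -- A large intercept already ruins the Gaussian part; a bounded one leaves the outlier with a
  -- residual of at least `r (t - R) - M`.
  rcases le_total M |α| with hα | hα
  · have h1 := hM α θ s hα hθ hs hsS
    rw [div_lt_iff₀ h1ε] at h1
    have h2 := mul_nonneg hε.le (h.nonneg ((r * t - α - r * ⟪e, θ⟫) / s))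
    linarith
  · have hg : g ρ S ≤ risk ρ (gaussianModel p) α θ s :=
      (h.antitoneOn_g hs hS hsS).trans
        ((g_le_g_div h hs (one_le_sqrt_one_add_sq _)).trans (g_le_risk_gaussianModel h α θ hs))
    have hρ : ρ ((r * (t - R) - M) / S) ≤ ρ ((r * t - α - r * ⟪e, θ⟫) / s) := by
      refine h.le_of_abs_le ?_
      rw [abs_of_nonneg hr0, abs_div, abs_of_pos hs]
      refine div_le_div₀ (abs_nonneg _) ?_ hs hsS
      have hin : ⟪e, θ⟫ ≤ R := (real_inner_le_norm e θ).trans (by rw [he, one_mul]; exact hθ)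
      have h3 := mul_le_mul_of_nonneg_left hin hrpos
      have h4 := le_abs_self (r * t - α - r * ⟪e, θ⟫)
      have h5 := (le_abs_self α).trans hα
      linarith
    have h1 := mul_le_mul_of_nonneg_left hg h1ε.le
    have h2 := mul_le_mul_of_nonneg_left hρ hε.le
    linarith

end Risk

/-! ### The bias function and quasi-concavity in the scale -/

section Bias

variable {ρ : ℝ → ℝ} {ε s t : ℝ}

lemma gInv_nonneg (ρ : ℝ → ℝ) (v : ℝ) : 0 ≤ gInv ρ v :=
  Real.sInf_nonneg fun _ hs => hs.1.le

lemma gInv_le {v : ℝ} (hs : 0 < s) (h : g ρ s ≤ v) : gInv ρ v ≤ s :=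
  csInf_le ⟨0, fun _ hr => hr.1.le⟩ ⟨hs, h⟩

lemma lt_g_of_lt_gInv {v : ℝ} (hs : 0 < s) (h : s < gInv ρ v) : v < g ρ s :=
  lt_of_not_ge fun hv => (gInv_le hs hv).not_gt h

lemma biasAt_sq (ρ : ℝ → ℝ) (ε s : ℝ) : biasAt ρ ε s ^ 2 =
    (ENNReal.ofReal s / ENNReal.ofReal (gInv ρ (g ρ s + ε / (1 - ε)))) ^ 2 - 1 := by
  rw [biasAt, ← ENNReal.rpow_natCast, ← ENNReal.rpow_mul]
  simp

lemma ofReal_sq_add_one (ht : 0 ≤ t) :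
    ENNReal.ofReal t ^ 2 + 1 = ENNReal.ofReal (√(1 + t ^ 2)) ^ 2 := by
  rw [← ENNReal.ofReal_pow ht, ← ENNReal.ofReal_pow (Real.sqrt_nonneg _),
    Real.sq_sqrt (by positivity), ← ENNReal.ofReal_one,
    ← ENNReal.ofReal_add (by positivity) zero_le_one, add_comm]

/-- Unwinding the square root, `t` exceeds the bias exactly when `s / √(1 + t²)` lies below the
generalized inverse, where `g` is above the level by definition of the infimum. -/
lemma lt_g_of_biasAt_lt (hs : 0 < s) (ht : 0 ≤ t) (h : biasAt ρ ε s < ENNReal.ofReal t) :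
    g ρ s + ε / (1 - ε) < g ρ (s / √(1 + t ^ 2)) := by
  have hk := one_le_sqrt_one_add_sq t
  have hk0 : 0 < √(1 + t ^ 2) := by linarith
  refine lt_g_of_lt_gInv (by positivity) ?_
  set G := gInv ρ (g ρ s + ε / (1 - ε)) with hG
  have h2 : biasAt ρ ε s ^ 2 < ENNReal.ofReal t ^ 2 := by gcongr
  rw [biasAt_sq] at h2
  have h3 : (ENNReal.ofReal s / ENNReal.ofReal G) ^ 2 < ENNReal.ofReal (√(1 + t ^ 2)) ^ 2 := by
    rw [← ofReal_sq_add_one ht]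
    exact le_tsub_add.trans_lt (ENNReal.add_lt_add_right ENNReal.one_ne_top h2)
  have h4 := lt_of_pow_lt_pow_left' 2 h3
  -- A vanishing inverse makes the quotient `∞`, so no finite `t` could exceed the bias.
  have hG0 : 0 < G := by
    refine (gInv_nonneg _ _).lt_of_ne fun h0 => ?_
    rw [← hG] at h0
    rw [← h0, ENNReal.ofReal_zero, ENNReal.div_zero (by simpa using hs)] at h4
    exact not_top_lt h4
  rw [← ENNReal.ofReal_div_of_pos hG0, ENNReal.ofReal_lt_ofReal_iff hk0, div_lt_iff₀ hG0] at h4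
  rw [div_lt_iff₀ hk0]
  linarith

/-- Here some `r` in the set defining the inverse lies below `s / √(1 + t²)`; strict monotonicity of
`g` turns this into a strict inequality. -/
lemma g_lt_of_lt_biasAt (hanti : StrictAntiOn (g ρ) (Ioi 0)) (hε : 0 ≤ ε) (hε1 : ε ≤ 1)
    (hs : 0 < s) (ht : 0 ≤ t) (h : ENNReal.ofReal t < biasAt ρ ε s) :
    g ρ (s / √(1 + t ^ 2)) < g ρ s + ε / (1 - ε) := by
  have hk := one_le_sqrt_one_add_sq t
  have hk0 : 0 < √(1 + t ^ 2) := by linarith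
  have hlt : gInv ρ (g ρ s + ε / (1 - ε)) < s / √(1 + t ^ 2) := by
    set G := gInv ρ (g ρ s + ε / (1 - ε)) with hG
    rcases (gInv_nonneg ρ (g ρ s + ε / (1 - ε))).eq_or_lt with h0 | hG0
    · rw [hG, ← h0]
      positivity
    rw [← hG] at hG0
    have h2 : ENNReal.ofReal t ^ 2 < biasAt ρ ε s ^ 2 := by gcongr
    rw [biasAt_sq, lt_tsub_iff_right, ofReal_sq_add_one ht] at h2
    have h4 := lt_of_pow_lt_pow_left' 2 h2
    rw [← hG, ← ENNReal.ofReal_div_of_pos hG0, ENNReal.ofReal_lt_ofReal_iff (by positivity),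
      lt_div_iff₀ hG0] at h4
    rw [lt_div_iff₀ hk0]
    linarith
  have hne : {r : ℝ | 0 < r ∧ g ρ r ≤ g ρ s + ε / (1 - ε)}.Nonempty :=
    ⟨s, hs, le_add_of_nonneg_right (div_nonneg hε (by linarith))⟩
  obtain ⟨r, ⟨hr0, hr⟩, hrlt⟩ := exists_lt_of_csInf_lt hne hlt
  exact (hanti hr0 (div_pos hs hk0) hrlt).trans_le hr

/-- For a unimodal score, `G(s / k) - G(s)` is a quasi-concave function of `s`. -/
lemma IsUnimodalScore.lt_sub {G : ℝ → ℝ} (hG : IsUnimodalScore G) {k c a d v : ℝ} (hk : 1 ≤ k)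
    (ha : 0 < a) (hac : a ≤ c) (hcd : c ≤ d) (h1 : v < G (a / k) - G a)
    (h2 : v < G (d / k) - G d) : v < G (c / k) - G c := by
  have hk0 : 0 < k := by linarith
  have hdiff : ∀ x, 0 < x → HasDerivAt G (deriv G x) x := fun x hx =>
    ((hG.contDiff.differentiableOn one_ne_zero).differentiableAt (Ioi_mem_nhds hx)).hasDerivAt
  have hder : ∀ x, 0 < x → HasDerivAt (fun x => G (x / k) - G x)
      (deriv G (x / k) * (1 / k) - deriv G x) x := fun x hx =>
    ((hdiff (x / k) (by positivity)).comp x ((hasDerivAt_id x).div_const k)).sub (hdiff x hx)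
  obtain ⟨σM, hσM, hmono, hanti⟩ := hG.unimodal
  by_contra! hc
  have hac' : a < c := hac.lt_of_ne fun h => by subst h; linarith
  have hcd' : c < d := hcd.lt_of_ne fun h => by subst h; linarith
  have hmvt : ∀ x y, 0 < x → x < y → ∃ z ∈ Ioo x y,
      deriv G (z / k) * (1 / k) - deriv G z =
        ((G (y / k) - G y) - (G (x / k) - G x)) / (y - x) := fun x y hx hxy =>
    exists_hasDerivAt_eq_slope _ _ hxy
      (fun z hz => (hder z (hx.trans_le hz.1)).continuousAt.continuousWithinAt)
      fun z hz => hder z (hx.trans hz.1)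
  obtain ⟨z, hz, hzd⟩ := hmvt a c ha hac'
  obtain ⟨w, hw, hwd⟩ := hmvt c d (ha.trans hac') hcd'
  have hz0 : 0 < z := ha.trans hz.1
  have hzw : z < w := hz.2.trans hw.1
  have hw0 : 0 < w := hz0.trans hzw
  -- With `φ(x) = -x G'(x)` and `D(x) = G(x/k) - G(x)`, this is `x D'(x) = φ(x) - φ(x/k)`. A dip of
  -- `D` at `c` gives `D'(z) < 0 < D'(w)` with `z < w`. Unimodality then forces `w/k < σM < z`, and
  -- `φ(z/k) ≤ φ(w/k) < φ(w) ≤ φ(z) < φ(z/k)` is absurd.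
  have hscale : ∀ x, x * (deriv G (x / k) * (1 / k) - deriv G x) =
      -x * deriv G x - -(x / k) * deriv G (x / k) := fun x => by ring
  have hzneg : -z * deriv G z < -(z / k) * deriv G (z / k) := by
    rw [← sub_neg, ← hscale, hzd]
    exact mul_neg_of_pos_of_neg hz0 (div_neg_of_neg_of_pos (by linarith) (by linarith))
  have hwpos : -(w / k) * deriv G (w / k) < -w * deriv G w := by
    rw [← sub_pos, ← hscale, hwd]
    exact mul_pos hw0 (div_pos (by linarith) (by linarith))
  have hzk : z / k ≤ z := div_le_self hz0.le hk
  have hwk : w / k ≤ w := div_le_self hw0.le hk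
  have hzwk : z / k ≤ w / k := by gcongr
  have hz0k : 0 < z / k := by positivity
  have hzM : σM < z := by
    by_contra! hle
    have := hmono ⟨hz0k, hzk.trans hle⟩ ⟨hz0, hle⟩ hzk
    simp only at this
    linarith
  have hwM : w / k < σM := by
    by_contra! hle
    have := hanti hle (hle.trans hwk) hwk
    simp only at this
    linarith
  have e1 := hmono ⟨hz0k, hzwk.trans hwM.le⟩ ⟨hz0k.trans_le hzwk, hwM.le⟩ hzwk
  have e2 := hanti hzM.le (hzM.trans hzw).le hzw.le
  simp only at e1 e2
  linarith

end Bias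

/-! ### Range of the S-scale -/

section Scale

variable {p : ℕ} {ρ : ℝ → ℝ} {b ε : ℝ} {tS : Measure (Obs p) → ℝ}
  {TS : Measure (Obs p) → EuclideanSpace ℝ (Fin p)} {sS : Measure (Obs p) → ℝ}

lemma norm_le_of_maxBias_le {T : Measure (Obs p) → EuclideanSpace ℝ (Fin p)} {B : ℝ}
    (hB : 0 ≤ B) (hT : maxBias T ε ≤ ENNReal.ofReal B) {H : Measure (Obs p)}
    (hH : H ∈ contamination p ε) : ‖T H‖ ≤ B :=
  (ENNReal.ofReal_le_ofReal_iff hB).1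
    ((le_iSup₂ (f := fun H (_ : H ∈ contamination p ε) => ENNReal.ofReal ‖T H‖) H hH).trans hT)

lemma IsSSolution.g_div_le (h : IsLoss ρ) (hε : 0 ≤ ε) (hε1 : ε < 1) {H : Measure (Obs p)}
    (hH : H ∈ contamination p ε) {α : ℝ} {θ : EuclideanSpace ℝ (Fin p)} {s : ℝ}
    (hs : IsSSolution ρ b H α θ s) : g ρ (s / √(1 + ‖θ‖ ^ 2)) ≤ b / (1 - ε) := by
  rw [le_div_iff₀ (by linarith), mul_comm]
  exact (mul_g_le_risk h hε hε1.le hH α θ hs.pos).trans hs.feasible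

/-- Since `g` tends to one at `0`, small scales violate the level. Nonemptiness excludes the default
`sInf ∅ = 0`. -/
lemma gammaScale_pos (h : IsLoss ρ) (hb : b / (1 - ε) < 1)
    (hne : {s : ℝ | 0 < s ∧ g ρ s ≤ b / (1 - ε)}.Nonempty) : 0 < gammaScale ρ b ε := by
  obtain ⟨δ, hδ, hδg⟩ :=
    mem_nhdsGT_iff_exists_Ioo_subset.1 (h.tendsto_g_zero.eventually_const_lt hb)
  refine (mem_Ioi.1 hδ).trans_le (le_csInf hne fun s hs => ?_)
  by_contra! hlt
  exact hs.2.not_gt (hδg ⟨hs.1, hlt⟩)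

/-- If an S-functional has bounded slopes, then its scale, at a sufficiently remote point
contamination, exceeds every `S` at which the uncontaminated loss plus `ε` violates the
constraint. -/
lemma eventually_lt_scale (h : IsLoss ρ) {e : EuclideanSpace ℝ (Fin p)} (he : ‖e‖ = 1)
    (hε : 0 < ε) (hεb' : ε < 1 - b) (hε1 : ε < 1)
    (hS : ∀ H ∈ contamination p ε, IsSSolution ρ b H (tS H) (TS H) (sS H)) {B t S : ℝ}
    (hB : ∀ H ∈ contamination p ε, ‖TS H‖ ≤ B) (hBt : B < t) (hS0 : 0 < S)
    (hSb : b < (1 - ε) * g ρ S + ε) :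
    ∀ᶠ r in atTop, S < sS (pointContamination ε t e r) := by
  filter_upwards [eventually_lt_risk_pointContamination h he hε hε1 hBt hS0
    (by linarith : b < 1 - ε) hSb] with r hr
  by_contra! hle
  have hmem := pointContamination_mem ε t e r
  exact (hr _ _ _ (hB _ hmem) (hS _ hmem).pos hle).not_ge (hS _ hmem).feasible

/-- Not automatic: a loss that jumps at `0` keeps `g` away from `0`. It is the bounded S-slope that
forces `g` down to this level. -/
lemma sigma_set_nonempty (h : IsLoss ρ) {e : EuclideanSpace ℝ (Fin p)} (he : ‖e‖ = 1)
    (hε : 0 < ε) (hεb' : ε < 1 - b) (hε1 : ε < 1)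
    (hS : ∀ H ∈ contamination p ε, IsSSolution ρ b H (tS H) (TS H) (sS H)) {B : ℝ}
    (hB : ∀ H ∈ contamination p ε, ‖TS H‖ ≤ B) :
    {s : ℝ | 0 < s ∧ g ρ s ≤ (b - ε) / (1 - ε)}.Nonempty := by
  have h1ε : 0 < 1 - ε := by linarith
  have hmem := pointContamination_mem (p := p) ε 0 e 0
  set H := pointContamination ε 0 e 0
  set s₀ := sS H / √(1 + ‖TS H‖ ^ 2)
  have hs₀pos : 0 < s₀ := div_pos (hS H hmem).pos (by positivity)
  have hg₀ : g ρ s₀ ≤ b / (1 - ε) := (hS H hmem).g_div_le h hε.le hε1 hmem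
  -- Chosen so that the exact fit of slope norm `B + 1` has Gaussian risk `g ρ s₀` at scale `S`,
  -- hence is feasible; were `g ρ S` above the level, a remote outlier would push the S-scale past
  -- `S`.
  set S := s₀ * √(1 + (B + 1) ^ 2) with hSdef
  have hS0 : 0 < S := by positivity
  refine ⟨S, hS0, ?_⟩
  by_contra! hlt
  rw [div_lt_iff₀ h1ε] at hlt
  obtain ⟨r, hr⟩ := (eventually_lt_scale h he hε hεb' hε1 hS hB (lt_add_one B) hS0
    (by linarith)).exists
  refine hr.not_ge ((hS _ (pointContamination_mem ε _ e r)).minimal 0 ((B + 1) • e) S hS0 ?_)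
  rw [risk_pointContamination_fit h hε.le hε1.le _ he, hSdef,
    mul_div_cancel_right₀ _ (by positivity)]
  rw [le_div_iff₀ h1ε] at hg₀
  linarith

lemma scale_le_sigmaScale (h : IsLoss ρ) (hε : 0 ≤ ε) (hε1 : ε < 1)
    (hne : {s : ℝ | 0 < s ∧ g ρ s ≤ (b - ε) / (1 - ε)}.Nonempty) {H : Measure (Obs p)}
    (hH : H ∈ contamination p ε) {α : ℝ} {θ : EuclideanSpace ℝ (Fin p)} {s : ℝ}
    (hs : IsSSolution ρ b H α θ s) : s ≤ sigmaScale ρ b ε := by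
  refine le_csInf hne fun r hr => hs.minimal 0 0 r hr.1 ((risk_zero_le h hε hε1.le hH r).trans ?_)
  have := (le_div_iff₀ (by linarith)).1 hr.2
  linarith

lemma gammaScale_le_scale (h : IsLoss ρ) (hε : 0 ≤ ε) (hε1 : ε < 1) {H : Measure (Obs p)}
    (hH : H ∈ contamination p ε) {α : ℝ} {θ : EuclideanSpace ℝ (Fin p)} {s : ℝ}
    (hs : IsSSolution ρ b H α θ s) : gammaScale ρ b ε ≤ s :=
  (gInv_le (div_pos hs.pos (by positivity)) (hs.g_div_le h hε hε1 hH)).trans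
    (div_le_self hs.pos.le (one_le_sqrt_one_add_sq _))

lemma eventually_lt_scale_of_lt_sigmaScale (h : IsLoss ρ) {e : EuclideanSpace ℝ (Fin p)}
    (he : ‖e‖ = 1) (hε : 0 < ε) (hεb' : ε < 1 - b) (hε1 : ε < 1)
    (hS : ∀ H ∈ contamination p ε, IsSSolution ρ b H (tS H) (TS H) (sS H)) {B t S : ℝ}
    (hB : ∀ H ∈ contamination p ε, ‖TS H‖ ≤ B) (hBt : B < t) (hS0 : 0 < S)
    (hSσ : S < sigmaScale ρ b ε) :
    ∀ᶠ r in atTop, S < sS (pointContamination ε t e r) := by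
  have hlt := lt_g_of_lt_gInv hS0 hSσ
  rw [div_lt_iff₀ (by linarith)] at hlt
  exact eventually_lt_scale h he hε hεb' hε1 hS hB hBt hS0 (by linarith)

/-- The zero fit bounds every S-scale by `sigmaScale`, and outliers on planes steeper than `B`
approach that bound. -/
lemma supScale_eq (h : IsLoss ρ) {e : EuclideanSpace ℝ (Fin p)} (he : ‖e‖ = 1)
    (hε : 0 < ε) (hεb' : ε < 1 - b) (hε1 : ε < 1)
    (hS : ∀ H ∈ contamination p ε, IsSSolution ρ b H (tS H) (TS H) (sS H)) {B : ℝ}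
    (hB : ∀ H ∈ contamination p ε, ‖TS H‖ ≤ B) : supScale sS ε = sigmaScale ρ b ε := by
  have hne := sigma_set_nonempty h he hε hεb' hε1 hS hB
  have hmem := pointContamination_mem (p := p) ε 0 e 0
  have hle : ∀ H ∈ contamination p ε, sS H ≤ sigmaScale ρ b ε := fun H hH =>
    scale_le_sigmaScale h hε.le hε1 hne hH (hS H hH)
  refine csSup_eq_of_forall_le_of_forall_lt_exists_gt ⟨_, mem_image_of_mem sS hmem⟩ ?_ ?_
  · rintro _ ⟨H, hH, rfl⟩
    exact hle H hH
  · intro w hw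
    have hσ : 0 < sigmaScale ρ b ε := (hS _ hmem).pos.trans_le (hle _ hmem)
    obtain ⟨S, hwS, hSσ⟩ := exists_between (max_lt hw hσ)
    obtain ⟨r, hr⟩ := (eventually_lt_scale_of_lt_sigmaScale h he hε hεb' hε1 hS hB
      (lt_add_one B) ((le_max_right _ _).trans_lt hwS) hSσ).exists
    exact ⟨_, mem_image_of_mem sS (pointContamination_mem ε _ e r),
      ((le_max_left _ _).trans_lt hwS).trans hr⟩

end Scale

/-! ### Maximum bias of the MM-functional -/

section MaxBias

variable {p : ℕ} {ρ : ℝ → ℝ} {ε : ℝ}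

/-- Any `t` beyond `biasAt ρ ε s` satisfies `m(t, s) ≥ ε/(1-ε)`. This converts the hypothesis on
`h₁⁻¹` into `B_S < ℓ(ε)`. -/
lemma incInv_mFun_le_biasAt (hp : 1 ≤ p) (h : IsLoss ρ) {s : ℝ} (hs : 0 < s) :
    incInv (fun t => mFun p ρ t s) (ε / (1 - ε)) ≤ biasAt ρ ε s := by
  refine le_of_forall_gt fun c hc => ?_
  obtain ⟨t, ht, htc⟩ := ENNReal.lt_iff_exists_real_btwn.1 hc |>.imp fun t ht => ht.2
  have ht0 : 0 ≤ t := (ENNReal.ofReal_pos.1 (pos_of_gt ht)).le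
  refine lt_of_le_of_lt (iInf₂_le t ⟨ht0, ?_⟩) htc
  change ε / (1 - ε) ≤ mFun p ρ t s
  rw [mFun_eq hp h ht0 hs]
  have := lt_g_of_biasAt_lt hs ht0 ht
  linarith

/-- An MM-solution cannot have slopes of norm `t` when the gain in loss exceeds `ε / (1 - ε)`. -/
lemma IsMMSolution.sub_le (h : IsLoss ρ) (hε : 0 ≤ ε) (hε1 : ε < 1) {H : Measure (Obs p)}
    (hH : H ∈ contamination p ε) {α : ℝ} {θ : EuclideanSpace ℝ (Fin p)} {s : ℝ} (hs : 0 < s)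
    (hM : IsMMSolution ρ s H α θ) : g ρ (s / √(1 + ‖θ‖ ^ 2)) - g ρ s ≤ ε / (1 - ε) := by
  have h1 := (mul_g_le_risk h hε hε1.le hH α θ hs).trans
    ((hM 0 0).trans (risk_zero_le h hε hε1.le hH s))
  rw [le_div_iff₀ (by linarith)]
  linarith

/-- The maximum bias of an MM-functional whose preliminary scale stays in `[c, d]`. -/
lemma maxBias_le_max_biasAt (h : IsLoss ρ) (hg : IsUnimodalScore (g ρ)) (hε : 0 ≤ ε)
    (hε1 : ε < 1) {c d : ℝ} (hc : 0 < c) {tM : Measure (Obs p) → ℝ}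
    {TM : Measure (Obs p) → EuclideanSpace ℝ (Fin p)} {s : Measure (Obs p) → ℝ}
    (hcs : ∀ H ∈ contamination p ε, c ≤ s H) (hsd : ∀ H ∈ contamination p ε, s H ≤ d)
    (hM : ∀ H ∈ contamination p ε, IsMMSolution ρ (s H) H (tM H) (TM H)) :
    maxBias TM ε ≤ max (biasAt ρ ε d) (biasAt ρ ε c) := by
  refine iSup₂_le fun H hH => ?_
  by_contra! hlt
  have hsH : 0 < s H := hc.trans_le (hcs H hH)
  have h1 := lt_g_of_biasAt_lt hc (norm_nonneg (TM H)) ((le_max_right _ _).trans_lt hlt)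
  have h2 := lt_g_of_biasAt_lt (hsH.trans_le (hsd H hH)) (norm_nonneg (TM H))
    ((le_max_left _ _).trans_lt hlt)
  have h3 := hg.lt_sub (v := ε / (1 - ε)) (one_le_sqrt_one_add_sq ‖TM H‖) hc (hcs H hH) (hsd H hH)
    (by linarith) (by linarith)
  exact h3.not_ge ((hM H hH).sub_le h hε hε1 hH hsH)

/-- The maximum bias of an MM-functional whose preliminary scale approaches its upper bound `d`
at remote point contaminations of every large slope. -/
lemma biasAt_le_maxBias (h : IsLoss ρ) (hanti : StrictAntiOn (g ρ) (Ioi 0))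
    (hcont : ContinuousOn (g ρ) (Ioi 0)) (hε : 0 < ε) (hε1 : ε < 1)
    {e : EuclideanSpace ℝ (Fin p)} (he : ‖e‖ = 1) {B d : ℝ} (hd : 0 < d)
    (hBd : ENNReal.ofReal B < biasAt ρ ε d)
    {tM : Measure (Obs p) → ℝ} {TM : Measure (Obs p) → EuclideanSpace ℝ (Fin p)}
    {s : Measure (Obs p) → ℝ} (hs0 : ∀ H ∈ contamination p ε, 0 < s H)
    (hsd : ∀ H ∈ contamination p ε, s H ≤ d)
    (hlim : ∀ t, B < t → ∀ S, 0 < S → S < d →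
      ∀ᶠ r in atTop, S < s (pointContamination ε t e r))
    (hM : ∀ H ∈ contamination p ε, IsMMSolution ρ (s H) H (tM H) (TM H)) :
    biasAt ρ ε d ≤ maxBias TM ε := by
  have h1ε : 0 < 1 - ε := by linarith
  refine le_of_forall_lt fun c hc => ?_
  -- The outlier has slope `t`; the gap `R < t` makes its residual diverge uniformly over all fits
  -- of slope norm at most `R`.
  obtain ⟨R, hR0, hcR, hRd⟩ := ENNReal.lt_iff_exists_real_btwn.1 (max_lt hc hBd)
  obtain ⟨t, ht0, hRt, htd⟩ := ENNReal.lt_iff_exists_real_btwn.1 hRd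
  replace hRt := (ENNReal.ofReal_lt_ofReal_iff_of_nonneg hR0).1 hRt
  have hBt : B < t := (lt_of_not_ge fun hle =>
    ((le_max_right _ _).trans_lt hcR).not_ge (ENNReal.ofReal_le_ofReal hle)).trans hRt
  set k := √(1 + t ^ 2) with hk
  have hk0 : 0 < k := by positivity
  have hdk : 0 < d / k := by positivity
  have hgd : (1 - ε) * g ρ (d / k) < (1 - ε) * g ρ d + ε := by
    have := g_lt_of_lt_biasAt hanti hε.le hε1.le hd ht0 htd
    rw [← sub_lt_iff_lt_add', lt_div_iff₀ h1ε] at this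
    linarith
  -- The scale only approaches `d`, so the strict inequality is moved by continuity to some `S < d`
  -- that the scale eventually exceeds.
  obtain ⟨S, hSd, hS0, hSg⟩ : ∃ S < d, 0 < S ∧ (1 - ε) * g ρ (S / k) < (1 - ε) * g ρ d + ε := by
    have hc1 : ContinuousAt (fun S => (1 - ε) * g ρ (S / k)) d :=
      (ContinuousAt.comp (f := fun S : ℝ => S / k) (hcont.continuousAt (Ioi_mem_nhds hdk))
        (by fun_prop)).const_mul _
    have hev := (hc1.eventually_lt_const hgd).and (lt_mem_nhds hd)
    obtain ⟨S, hS, hSd⟩ := ((hev.filter_mono nhdsWithin_le_nhds).and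
      (self_mem_nhdsWithin (s := Iio d))).exists
    exact ⟨S, hSd, hS.2, hS.1⟩
  have hSk : 0 < S / k := by positivity
  have hlt1 : g ρ (S / k) < 1 :=
    (hanti (half_pos hSk) hSk (half_lt_self hSk)).trans_le (h.g_le_one _)
  obtain ⟨r, hr1, hr2⟩ := ((hlim t hBt S hS0 hSd).and
    (eventually_lt_risk_pointContamination h he hε hε1 hRt hd
      (by nlinarith : (1 - ε) * g ρ (S / k) < 1 - ε) hSg)).exists
  have hmem := pointContamination_mem ε t e r
  set H := pointContamination ε t e r with hH
  have hnorm : R < ‖TM H‖ := by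
    by_contra! hle
    refine (hr2 (tM H) (TM H) (s H) hle (hs0 H hmem) (hsd H hmem)).not_ge
      ((hM H hmem 0 (t • e)).trans ?_)
    rw [hH, risk_pointContamination_fit h hε.le hε1.le t he, ← hH]
    refine mul_le_mul_of_nonneg_left (h.antitoneOn_g hSk ?_ ?_) h1ε.le
    · exact div_pos (hs0 H hmem) hk0
    · exact div_le_div_of_nonneg_right hr1.le hk0.le
  calc c < ENNReal.ofReal R := (le_max_left _ _).trans_lt hcR
    _ ≤ ENNReal.ofReal ‖TM H‖ := ENNReal.ofReal_le_ofReal hnorm.le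
    _ ≤ maxBias TM ε :=
      le_iSup₂ (f := fun H (_ : H ∈ contamination p ε) => ENNReal.ofReal ‖TM H‖) H hmem

end MaxBias

end MMRegression

/-! ### The two bounds combined -/

theorem theorem4p2 (p : ℕ) (hp : 1 ≤ p) (ρ₁ ρ₂ : ℝ → ℝ) (hρ₁ : IsLoss ρ₁) (hρ₂ : IsLoss ρ₂)
    (hle : ∀ u, ρ₂ u ≤ ρ₁ u) (b ε : ℝ) (hε : 0 < ε) (hεb : ε < b) (hεb' : ε < 1 - b)
    -- the S-functional (intercept, slopes, scale) based on `ρ₁`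
    (tS : MeasureTheory.Measure (Obs p) → ℝ)
    (TS : MeasureTheory.Measure (Obs p) → EuclideanSpace ℝ (Fin p))
    (sS : MeasureTheory.Measure (Obs p) → ℝ)
    (hS : ∀ H ∈ contamination p ε, IsSSolution ρ₁ b H (tS H) (TS H) (sS H))
    -- the MM-functional (intercept, slopes) based on `ρ₂` and the preliminary scale `sS`
    (tMM : MeasureTheory.Measure (Obs p) → ℝ)
    (TMM : MeasureTheory.Measure (Obs p) → EuclideanSpace ℝ (Fin p))
    (hMM : ∀ H ∈ contamination p ε, IsMMSolution ρ₂ (sS H) H (tMM H) (TMM H))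
    -- `B_S(ε) < h₁⁻¹[ε / (1 - ε)]` with `h₁(t) = m(t, s̄)`
    (hBS : maxBias TS ε < incInv (fun t => mFun p ρ₂ t (supScale sS ε)) (ε / (1 - ε)))
    (hg₂ : IsUnimodalScore (g ρ₂)) :
    lowerBound ρ₁ ρ₂ b ε ≤ maxBias TMM ε ∧
      maxBias TMM ε ≤ max (lowerBound ρ₁ ρ₂ b ε) (upperTerm ρ₁ ρ₂ b ε) ∧
      (upperTerm ρ₁ ρ₂ b ε ≤ lowerBound ρ₁ ρ₂ b ε →
        maxBias TMM ε = lowerBound ρ₁ ρ₂ b ε) := by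
  have hε1 : ε < 1 := by linarith
  have h1ε : 0 < 1 - ε := by linarith
  have : NeZero p := ⟨by lia⟩
  obtain ⟨e, he⟩ : ∃ e : EuclideanSpace ℝ (Fin p), ‖e‖ = 1 := exists_norm_eq _ zero_le_one
  have hfin : maxBias TS ε ≠ ⊤ := hBS.ne_top
  set B := (maxBias TS ε).toReal with hBdef
  have hofB : ENNReal.ofReal B = maxBias TS ε := ENNReal.ofReal_toReal hfin
  have hB : ∀ H ∈ contamination p ε, ‖TS H‖ ≤ B := fun H hH =>
    norm_le_of_maxBias_le ENNReal.toReal_nonneg hofB.ge hH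
  have hne := sigma_set_nonempty hρ₁ he hε hεb' hε1 hS hB
  have hmem := pointContamination_mem (p := p) ε 0 e 0
  have hσ : ∀ H ∈ contamination p ε, sS H ≤ sigmaScale ρ₁ b ε := fun H hH =>
    scale_le_sigmaScale hρ₁ hε.le hε1 hne hH (hS H hH)
  have hγ : ∀ H ∈ contamination p ε, gammaScale ρ₁ b ε ≤ sS H := fun H hH =>
    gammaScale_le_scale hρ₁ hε.le hε1 hH (hS H hH)
  have hσ0 : 0 < sigmaScale ρ₁ b ε := (hS _ hmem).pos.trans_le (hσ _ hmem)
  have hb1 : b / (1 - ε) < 1 := (div_lt_one h1ε).2 (by linarith)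
  obtain ⟨s₀, hs₀, hg₀⟩ : {s : ℝ | 0 < s ∧ g ρ₁ s ≤ b / (1 - ε)}.Nonempty :=
    ⟨_, div_pos (hS _ hmem).pos (by positivity), (hS _ hmem).g_div_le hρ₁ hε.le hε1 hmem⟩
  have hγ0 : 0 < gammaScale ρ₁ b ε := gammaScale_pos hρ₁ hb1 ⟨s₀, hs₀, hg₀⟩
  -- The domination `ρ₂ ≤ ρ₁` enters here: `g ρ₂` drops below one somewhere, hence is strictly
  -- decreasing.
  have hg₂lt : g ρ₂ s₀ < 1 :=
    ((MeasureTheory.integral_mono (hρ₂.integrable (by fun_prop)) (hρ₁.integrable (by fun_prop))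
      fun z => hle _).trans hg₀).trans_lt hb1
  have hlower : lowerBound ρ₁ ρ₂ b ε ≤ maxBias TMM ε := by
    refine biasAt_le_maxBias hρ₂ (hρ₂.strictAntiOn_g hs₀ hg₂lt) hg₂.contDiff.continuousOn hε hε1 he
      hσ0 (B := B) ?_ (fun H hH => (hS H hH).pos) hσ (fun t ht S hS0 hSσ =>
        eventually_lt_scale_of_lt_sigmaScale hρ₁ he hε hεb' hε1 hS hB ht hS0 hSσ) hMM
    rw [hofB]
    rw [supScale_eq hρ₁ he hε hεb' hε1 hS hB] at hBS
    exact hBS.trans_le (incInv_mFun_le_biasAt hp hρ₂ hσ0)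
  have hupper : maxBias TMM ε ≤ max (lowerBound ρ₁ ρ₂ b ε) (upperTerm ρ₁ ρ₂ b ε) :=
    maxBias_le_max_biasAt hρ₂ hg₂ hε.le hε1 hγ0 hγ hσ hMM
  exact ⟨hlower, hupper, fun h => le_antisymm (hupper.trans_eq (max_eq_left h)) hlower⟩
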